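/- Let $d\ge 1$, $\lambda=(\lambda_1,\dots,\lambda_d)\ne 0$, $p(x)=\sum_{i=1}^d\lambda_i x^i$ and $|\lambda|=\sum_{i=1}^d|\lambda_i|$. For real $\lambda$ let $X$ be the Liénard vector field $$\dot x=y,\qquad \dot y=-x+p(x)\,y .$$ Its return mapping sends $r>0$ to the number $s>0$ such that the trajectory of $X$ starting at $(r,0)$ meets the positive $x$-axis again for the first time at $(s,0)$. In polar coordinates $x=r\cos\theta$, $y=r\sin\theta$ (the angle decreases along small trajectories) the trajectories satisfy $$\frac{dr}{d\theta}=\frac{r\,p(r\cos\theta)\sin^2\theta}{-1+\sin\theta\cos\theta\,p(r\cos\theta)},\qquad(*)$$ and for $\lambda\in\mathbb C^d$ and complex $r$ the return mapping is the mapping $r(2\pi)\mapsto r(0)$ along solutions $r:[0,2\pi]\to\mathbb C$ of $(*)$ whose denominator does not vanish. For every $\lambda\in\mathbb C^d\setminus\{0\}$ there is a unique $\rho>0$ with $$\rho^d|\lambda_d|+\dots+\rho|\lambda_1|=1,$$ and the return mapping converges at least on the disc $D(0,\rho/2)$: there is a power series $\sum_k a_kz^k$ which converges for all complex $z$ with $|z|<\rho/2$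 and whose sum there is the image of $z$ under the return mapping (in particular the solution of $(*)$ with $r(2\pi)=z$ exists on $[0,2\pi]$). If $\lambda$ is real and $0<r<\rho/2$, the sum at $r$ is the value at $r$ of the return mapping of $X$. The same holds, on the same disc, for the inverse of the return mapping. Moreover $\rho/2$ improves the bound $1/(1+|\lambda|)$ for small $|\lambda|$, but not in general for large $|\lambda|$: there is $\varepsilon>0$, depending only on $d$, such that $\rho/2>1/(1+|\lambda|)$ whenever $0<|\lambda|<\varepsilon$, while for every $M$ there is a real $\lambda$ with $|\lambda|>M$ and $\rho/2<1/(1+|\lambda|)$. -/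

import Mathlib

noncomputable section

/-- `p(x) = ∑_{i=1}^d λ_i x^i`; the coefficient `λ_i` is `lam (i - 1)`. -/
def lienardPoly {K : Type*} [CommSemiring K] {d : ℕ} (lam : Fin d → K) (x : K) : K :=
  ∑ i : Fin d, lam i * x ^ (i.val + 1)

/-- The Liénard vector field `X = y ∂/∂x + (-x + p(x) y) ∂/∂y`, that is
the system `dx/dt = y`, `dy/dt = -x + p(x) y`. -/
def lienardField {d : ℕ} (lam : Fin d → ℝ) (q : ℝ × ℝ) : ℝ × ℝ :=
  (q.2, -q.1 + lienardPoly lam q.1 * q.2)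

/-- The real return mapping of the field on the positive `x`-axis, as a relation: the
trajectory which starts at `(r, 0)`, `r > 0`, meets the positive `x`-axis again for the first
(positive) time at `(s, 0)`. -/
def IsFirstReturn {d : ℕ} (lam : Fin d → ℝ) (r s : ℝ) : Prop :=
  0 < r ∧ 0 < s ∧ ∃ T : ℝ, 0 < T ∧ ∃ γ : ℝ → ℝ × ℝ,
    (∀ t ∈ Set.Icc 0 T, HasDerivWithinAt γ (lienardField lam (γ t)) (Set.Icc 0 T) t) ∧
    γ 0 = (r, 0) ∧ γ T = (s, 0) ∧
    ∀ t ∈ Set.Ioo 0 T, ¬ (0 < (γ t).1 ∧ (γ t).2 = 0)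

/-- The factor `-1 + sin θ cos θ p(r cos θ)`, the angular velocity of the field in polar
coordinates. -/
def polarAngular {d : ℕ} (lam : Fin d → ℂ) (θ : ℝ) (r : ℂ) : ℂ :=
  -1 + (Real.sin θ : ℂ) * (Real.cos θ : ℂ) * lienardPoly lam (r * (Real.cos θ : ℂ))

/-- Right-hand side of the polar equation
`dr/dθ = r p(r cos θ) sin² θ / (-1 + sin θ cos θ p(r cos θ))`. -/
def polarSlope {d : ℕ} (lam : Fin d → ℂ) (θ : ℝ) (r : ℂ) : ℂ :=
  r * lienardPoly lam (r * (Real.cos θ : ℂ)) * (Real.sin θ : ℂ) ^ 2 / polarAngular lam θ r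

/-- The complexified return mapping, as a relation: the solution of the polar equation with
value `z` at `θ = 2π` exists down to `θ = 0` and has the value `w` there.  (The field turns
clockwise, so the angle decreases as time increases.) -/
def IsReturn {d : ℕ} (lam : Fin d → ℂ) (z w : ℂ) : Prop :=
  ∃ r : ℝ → ℂ, r (2 * Real.pi) = z ∧ r 0 = w ∧
    ∀ θ ∈ Set.Icc 0 (2 * Real.pi), polarAngular lam θ (r θ) ≠ 0 ∧
      HasDerivWithinAt r (polarSlope lam θ (r θ)) (Set.Icc 0 (2 * Real.pi)) θ

/-- `ρ` is a positive solution of `ρ^d |λ_d| + ⋯ + ρ |λ_1| = 1`. -/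
def IsScale {d : ℕ} (lam : Fin d → ℂ) (ρ : ℝ) : Prop :=
  0 < ρ ∧ ∑ i : Fin d, ρ ^ (i.val + 1) * ‖lam i‖ = 1

end

open Set

/-! ### Scalar linear equations -/

/-! The substitution `r = ρ q` turns `λ_i` into `λ_i ρ^i`, so one may assume `∑ |λ_i| = 1` and `ρ =
1`. On the closed unit disc `|p| ≤ 1` and `|sin θ cos θ| ≤ 1/2`, so the denominator of the polar
equation does not vanish. What must be shown is that a solution with `|r(2π)| < 1/2` stays in the
disc on all of `[0, 2π]`.

Along a nonzero solution, `(1/r)' = sin² θ p / (r (1 - sin θ cos θ p))`. Its main term `λ_1 sin² θ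
cos θ` is the derivative of `λ_1 sin³ θ / 3`, so it is removed by passing to `V = 1/r - λ_1 sin³ θ /
3`. The remainder is `O(|r|) (sin θ cos θ)²`, and `|V| |r|` is bounded, so `(V²)'` is at most a
constant times `(sin θ cos θ)²`, whose integral over a period is `π/4`. As `|V(2π)| > 2`, enough is
left of `|V|²` to force `|r| < 9/10` (`norm_deriv_inv_sub_le`, `radius_margin`,
`norm_lt_of_polar_solution`). Existence then follows by truncating the equation outside the disc and
excluding a crossing of `|r| = 9/10`.

The difference of two solutions satisfies a scalar linear equation whose coefficient is the divided
difference of the slope, hence is its end value times an exponential (`IsPolarSolution.sub_eq`).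
This gives uniqueness, complex differentiability in the end value (so a Taylor series on the whole
disc), and, for real parameters, reality and positivity. A change of time carries real solutions to
orbits of the field. The inverse mapping is the return mapping for `-λ`, which has the same `ρ`. -/

theorem eq_mul_exp_of_hasDerivWithinAt_mul {a b : ℝ} {f A : ℝ → ℂ} (hab : a ≤ b)
    (hA : ContinuousOn A (Icc a b))
    (hf : ∀ t ∈ Icc a b, HasDerivWithinAt f (A t * f t) (Icc a b) t) {t : ℝ}
    (ht : t ∈ Icc a b) : f t = f b * Complex.exp (∫ s in b..t, A s) := by
  -- Extending `A` continuously to the line makes its primitive differentiable at every point,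
  -- endpoints included; the integrating factor `exp (-P)` then does the rest.
  set B : ℝ → ℂ := IccExtend hab ((Icc a b).domRestrict A) with hB
  have hBc : Continuous B := (continuousOn_iff_continuous_domRestrict.1 hA).Icc_extend'
  have hBA : ∀ s ∈ Icc a b, B s = A s := fun s hs => by
    rw [hB, IccExtend_of_mem hab _ hs]; rfl
  have hint : ∫ s in b..t, A s = ∫ s in b..t, B s := by
    refine intervalIntegral.integral_congr fun s hs => (hBA s ?_).symm
    rw [uIcc_of_ge ht.2] at hs
    exact ⟨ht.1.trans hs.1, hs.2⟩
  set P : ℝ → ℂ := fun u => ∫ s in b..u, B s with hP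
  have hPd : ∀ u, HasDerivAt P (B u) u := fun u => hBc.integral_hasStrictDerivAt b u |>.hasDerivAt
  have hg : ∀ u ∈ Icc a b,
      HasDerivWithinAt (fun u => f u * Complex.exp (-P u)) 0 (Icc a b) u := fun u hu => by
    refine ((hf u hu).mul (hPd u).neg.cexp.hasDerivWithinAt).congr_deriv ?_
    rw [hBA u hu]; simp; ring
  have key := (convex_Icc a b).norm_image_sub_le_of_norm_hasDerivWithin_le (C := 0) hg
    (fun _ _ => by simp) (right_mem_Icc.2 hab) ht
  have hPb : P b = 0 := by simp [hP]
  simp only [hPb, neg_zero, Complex.exp_zero, mul_one, zero_mul, norm_le_zero_iff, sub_eq_zero]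
    at key
  rw [hint, ← key, mul_assoc, ← Complex.exp_add]
  simp [hP]

/-! ### The polar equation on the disc of radius `ρ` -/

/-- The divided difference of `lienardPoly`. -/
def lienardQuot {d : ℕ} (lam : Fin d → ℂ) (x y : ℂ) : ℂ :=
  ∑ i : Fin d, lam i * ∑ j ∈ Finset.range (i.val + 1), x ^ j * y ^ (i.val + 1 - 1 - j)

theorem lienardPoly_sub {d : ℕ} (lam : Fin d → ℂ) (x y : ℂ) :
    lienardPoly lam x - lienardPoly lam y = lienardQuot lam x y * (x - y) := by
  simp only [lienardPoly, lienardQuot, Finset.sum_mul, ← Finset.sum_sub_distrib]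
  refine Finset.sum_congr rfl fun i _ => ?_
  rw [← mul_sub, ← (Commute.all x y).geom_sum₂_mul, mul_assoc]

/-- The divided difference of `polarSlope lam θ`. -/
noncomputable def polarQuot {d : ℕ} (lam : Fin d → ℂ) (θ : ℝ) (x y : ℂ) : ℂ :=
  ((Real.sin θ : ℂ) ^ 2 * (lienardPoly lam (x * Real.cos θ) +
      y * (Real.cos θ * lienardQuot lam (x * Real.cos θ) (y * Real.cos θ))) *
      polarAngular lam θ y -
    (Real.sin θ : ℂ) ^ 2 * y * lienardPoly lam (y * Real.cos θ) *
      (Real.sin θ * (Real.cos θ : ℂ) ^ 2 *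
        lienardQuot lam (x * Real.cos θ) (y * Real.cos θ))) /
    (polarAngular lam θ x * polarAngular lam θ y)

/-- Polynomial divided differences combined by the quotient rule. The explicit formula keeps only
the two nonvanishing denominators, so it is continuous across the diagonal `x = y`. -/
theorem polarSlope_sub {d : ℕ} (lam : Fin d → ℂ) (θ : ℝ) {x y : ℂ}
    (hx : polarAngular lam θ x ≠ 0) (hy : polarAngular lam θ y ≠ 0) :
    polarSlope lam θ x - polarSlope lam θ y = polarQuot lam θ x y * (x - y) := by
  have h := lienardPoly_sub lam (x * Real.cos θ) (y * Real.cos θ)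
  have hD : polarAngular lam θ x - polarAngular lam θ y =
      Real.sin θ * (Real.cos θ : ℂ) ^ 2 * lienardQuot lam (x * Real.cos θ) (y * Real.cos θ) *
        (x - y) := by
    simp only [polarAngular]
    linear_combination (Real.sin θ : ℂ) * (Real.cos θ : ℂ) * h
  rw [polarSlope, polarSlope, polarQuot, div_sub_div _ _ hx hy, div_mul_eq_mul_div]
  congr 1
  linear_combination ((Real.sin θ : ℂ) ^ 2 * y * polarAngular lam θ y) * h -
    (Real.sin θ : ℂ) ^ 2 * y * lienardPoly lam (y * Real.cos θ) * hD

theorem polarSlope_zero {d : ℕ} (lam : Fin d → ℂ) (θ : ℝ) : polarSlope lam θ 0 = 0 := by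
  simp [polarSlope]

theorem norm_lienardPoly_le {d : ℕ} {lam : Fin d → ℂ} {ρ : ℝ} (h : IsScale lam ρ) {x : ℂ}
    (hx : ‖x‖ ≤ ρ) : ‖lienardPoly lam x‖ ≤ 1 := by
  rw [← h.2, lienardPoly]
  refine (norm_sum_le _ _).trans (Finset.sum_le_sum fun i _ => ?_)
  rw [norm_mul, norm_pow, mul_comm]
  gcongr

theorem norm_mul_cos_le (x : ℂ) (θ : ℝ) : ‖x * (Real.cos θ : ℂ)‖ ≤ ‖x‖ := by
  rw [norm_mul, Complex.norm_real]
  exact mul_le_of_le_one_right (norm_nonneg _) (Real.abs_cos_le_one θ)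

theorem abs_sin_mul_cos_le (θ : ℝ) : |Real.sin θ * Real.cos θ| ≤ 1 / 2 := by
  rw [abs_le]
  constructor <;> nlinarith [Real.sin_sq_add_cos_sq θ, sq_nonneg (Real.sin θ - Real.cos θ),
    sq_nonneg (Real.sin θ + Real.cos θ)]

theorem polarAngular_ne_zero {d : ℕ} {lam : Fin d → ℂ} {ρ : ℝ} (h : IsScale lam ρ) (θ : ℝ)
    {x : ℂ} (hx : ‖x‖ ≤ ρ) : polarAngular lam θ x ≠ 0 := by
  intro h0
  have h1 : (Real.sin θ : ℂ) * Real.cos θ * lienardPoly lam (x * Real.cos θ) = 1 := by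
    rw [polarAngular] at h0; linear_combination h0
  have h2 := congrArg norm h1
  rw [norm_mul, ← Complex.ofReal_mul, Complex.norm_real, norm_one, Real.norm_eq_abs] at h2
  have h3 := norm_lienardPoly_le h ((norm_mul_cos_le x θ).trans hx)
  nlinarith [abs_sin_mul_cos_le θ, norm_nonneg (lienardPoly lam (x * Real.cos θ)),
    abs_nonneg (Real.sin θ * Real.cos θ)]

theorem continuous_polarAngular {d : ℕ} (lam : Fin d → ℂ) :
    Continuous fun q : ℝ × ℂ => polarAngular lam q.1 q.2 := by
  unfold polarAngular lienardPoly
  fun_prop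

theorem continuousOn_polarSlope {d : ℕ} {lam : Fin d → ℂ} {ρ : ℝ} (h : IsScale lam ρ) :
    ContinuousOn (fun q : ℝ × ℂ => polarSlope lam q.1 q.2) {q | ‖q.2‖ ≤ ρ} := by
  unfold polarSlope
  refine ContinuousOn.div ?_ (continuous_polarAngular lam).continuousOn
    fun q hq => polarAngular_ne_zero h _ hq
  unfold lienardPoly
  fun_prop

theorem continuousOn_polarQuot {d : ℕ} {lam : Fin d → ℂ} {ρ : ℝ} (h : IsScale lam ρ) :
    ContinuousOn (fun q : ℝ × ℂ × ℂ => polarQuot lam q.1 q.2.1 q.2.2)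
      {q | ‖q.2.1‖ ≤ ρ ∧ ‖q.2.2‖ ≤ ρ} := by
  unfold polarQuot
  refine ContinuousOn.div ?_ ?_ fun q hq =>
    mul_ne_zero (polarAngular_ne_zero h _ hq.1) (polarAngular_ne_zero h _ hq.2)
  · unfold lienardPoly lienardQuot polarAngular lienardPoly
    fun_prop
  · unfold polarAngular lienardPoly
    fun_prop

theorem exists_norm_polarQuot_le {d : ℕ} {lam : Fin d → ℂ} {ρ : ℝ} (h : IsScale lam ρ) :
    ∃ M : ℝ, 0 ≤ M ∧ ∀ θ ∈ Icc 0 (2 * Real.pi), ∀ x y : ℂ, ‖x‖ ≤ ρ → ‖y‖ ≤ ρ →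
      ‖polarQuot lam θ x y‖ ≤ M := by
  have hK : IsCompact (Icc 0 (2 * Real.pi) ×ˢ
      (Metric.closedBall (0 : ℂ) ρ ×ˢ Metric.closedBall (0 : ℂ) ρ)) :=
    isCompact_Icc.prod ((isCompact_closedBall _ _).prod (isCompact_closedBall _ _))
  obtain ⟨M, hM⟩ := hK.exists_bound_of_continuousOn ((continuousOn_polarQuot h).mono
    (by rintro ⟨t, x, y⟩ ⟨-, hx, hy⟩; simpa using And.intro hx hy))
  refine ⟨max M 0, le_max_right _ _, fun θ hθ x y hx hy => (hM (θ, x, y) ?_).trans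
    (le_max_left _ _)⟩
  exact ⟨hθ, by simpa using hx, by simpa using hy⟩

/-! ### Existence for the truncated equation -/

/-- A Lipschitz retraction of the plane onto the closed disc of radius `R`. -/
noncomputable def clampNorm (R : ℝ) (x : ℂ) : ℂ := ((R / max R ‖x‖ : ℝ) : ℂ) * x

theorem clampNorm_of_le {R : ℝ} (hR : 0 < R) {x : ℂ} (hx : ‖x‖ ≤ R) : clampNorm R x = x := by
  rw [clampNorm, max_eq_left hx, div_self hR.ne']; simp

theorem norm_clampNorm_le {R : ℝ} (hR : 0 < R) (x : ℂ) : ‖clampNorm R x‖ ≤ R := by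
  have hm : 0 < max R ‖x‖ := lt_max_of_lt_left hR
  rw [clampNorm, norm_mul, Complex.norm_real, Real.norm_eq_abs, abs_of_pos (div_pos hR hm),
    div_mul_eq_mul_div, div_le_iff₀ hm]
  gcongr
  exact le_max_right _ _

theorem norm_clampNorm_sub_le {R : ℝ} (hR : 0 < R) (x y : ℂ) :
    ‖clampNorm R x - clampNorm R y‖ ≤ 2 * ‖x - y‖ := by
  set m := max R ‖x‖ with hm
  set n := max R ‖y‖ with hn
  have hm0 : 0 < m := lt_max_of_lt_left hR
  have hn0 : 0 < n := lt_max_of_lt_left hR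
  have hmn : |n - m| ≤ ‖x - y‖ := by
    refine (abs_max_sub_max_le_max R ‖y‖ R ‖x‖).trans ?_
    rw [sub_self, abs_zero, max_eq_right (abs_nonneg _), norm_sub_rev]
    exact abs_norm_sub_norm_le y x
  have e : clampNorm R x - clampNorm R y =
      ((R / m : ℝ) : ℂ) * (x - y) + ((R / m * ((n - m) / n) : ℝ) : ℂ) * y := by
    have : (m : ℂ) ≠ 0 := by exact_mod_cast hm0.ne'
    have : (n : ℂ) ≠ 0 := by exact_mod_cast hn0.ne'
    rw [clampNorm, clampNorm, ← hm, ← hn]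
    push_cast
    field_simp
    ring
  have hRm : |R / m| ≤ 1 := by
    rw [abs_of_pos (by positivity), div_le_one hm0]; exact le_max_left _ _
  have hy : ‖y‖ / n ≤ 1 := (div_le_one hn0).2 (le_max_right _ _)
  rw [e]
  refine (norm_add_le _ _).trans ?_
  rw [norm_mul, norm_mul, Complex.norm_real, Complex.norm_real, Real.norm_eq_abs,
    Real.norm_eq_abs, abs_mul, abs_div (n - m), abs_of_pos hn0]
  have h1 : |R / m| * ‖x - y‖ ≤ 1 * ‖x - y‖ := by gcongr
  have h2 : |R / m| * (|n - m| / n) * ‖y‖ ≤ 1 * ‖x - y‖ := by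
    calc |R / m| * (|n - m| / n) * ‖y‖ = |R / m| * (|n - m| * (‖y‖ / n)) := by ring
      _ ≤ 1 * (‖x - y‖ * 1) := by gcongr
      _ = _ := by ring
  linarith

/-- After composition with the retraction the slope is bounded and Lipschitz in `r` on the whole
plane, so Picard–Lindelöf covers all of `[0, 2π]` for any end value. -/
theorem exists_truncated_solution {d : ℕ} {lam : Fin d → ℂ} {ρ : ℝ} (h : IsScale lam ρ) (z : ℂ) :
    ∃ r : ℝ → ℂ, r (2 * Real.pi) = z ∧ ∀ θ ∈ Icc 0 (2 * Real.pi),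
      HasDerivWithinAt r (polarSlope lam θ (clampNorm ρ (r θ))) (Icc 0 (2 * Real.pi)) θ := by
  obtain ⟨M, hM0, hM⟩ := exists_norm_polarQuot_le h
  have hρ := h.1
  have hpi := Real.pi_pos
  have hne : ∀ θ x, polarAngular lam θ (clampNorm ρ x) ≠ 0 := fun θ x =>
    polarAngular_ne_zero h θ (norm_clampNorm_le hρ x)
  have hPL : IsPicardLindelof (fun θ x => polarSlope lam θ (clampNorm ρ x))
      (⟨2 * Real.pi, by constructor <;> linarith⟩ : Icc (0 : ℝ) (2 * Real.pi)) z
      -- The slope vanishes at `0`, so it is bounded by `M ρ`; this radius is exactly what a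
      -- solution can travel in time `2π`. The factor `2` in the Lipschitz constant comes from the
      -- retraction.
      (Real.toNNReal (M * ρ * (2 * Real.pi))) 0 (Real.toNNReal (M * ρ))
      (Real.toNNReal (M * 2)) := by
    refine ⟨fun θ hθ => LipschitzOnWith.of_dist_le_mul fun x _ y _ => ?_, fun x _ => ?_,
      fun θ hθ x _ => ?_, ?_⟩
    · rw [dist_eq_norm, dist_eq_norm, polarSlope_sub lam θ (hne θ x) (hne θ y), norm_mul,
        Real.coe_toNNReal _ (by positivity), mul_assoc]
      exact mul_le_mul (hM θ hθ _ _ (norm_clampNorm_le hρ x) (norm_clampNorm_le hρ y))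
        (norm_clampNorm_sub_le hρ x y) (norm_nonneg _) hM0
    · exact (continuousOn_polarSlope h).comp (f := fun θ : ℝ => (θ, clampNorm ρ x)) (by fun_prop)
        fun θ _ => norm_clampNorm_le hρ x
    · have h0 : ‖(0 : ℂ)‖ ≤ ρ := by simpa using hρ.le
      have := polarSlope_sub lam θ (hne θ x) (polarAngular_ne_zero h θ h0)
      rw [polarSlope_zero, sub_zero, sub_zero] at this
      rw [this, norm_mul, Real.coe_toNNReal _ (by positivity)]
      exact mul_le_mul (hM θ hθ _ _ (norm_clampNorm_le hρ x) h0)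
        (norm_clampNorm_le hρ x) (norm_nonneg _) hM0
    · rw [Real.coe_toNNReal _ (by positivity), Real.coe_toNNReal _ (by positivity)]
      simp only [sub_self, sub_zero, NNReal.coe_zero]
      rw [max_eq_right (by positivity)]
  exact hPL.exists_eq_forall_mem_Icc_hasDerivWithinAt (by simp)

/-! ### The a priori estimate -/

/-- The coefficients beyond `lam 0`, that is `λ_1`, have total mass `1 - ‖lam 0‖`, and they carry
powers at least `2` of `x`. -/
theorem norm_lienardPoly_sub_linear_le {n : ℕ} {lam : Fin (n + 1) → ℂ}
    (hsum : ∑ i, ‖lam i‖ = 1) {x : ℂ} (hx : ‖x‖ ≤ 1) :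
    ‖lienardPoly lam x - lam 0 * x‖ ≤ (1 - ‖lam 0‖) * ‖x‖ ^ 2 := by
  rw [Fin.sum_univ_succ] at hsum
  rw [lienardPoly, Fin.sum_univ_succ, ← hsum]
  simp only [Fin.val_zero, zero_add, pow_one, add_sub_cancel_left, Finset.sum_mul]
  refine (norm_sum_le _ _).trans (Finset.sum_le_sum fun i _ => ?_)
  rw [norm_mul, norm_pow]
  gcongr ‖lam i.succ‖ * ?_
  exact pow_le_pow_of_le_one (norm_nonneg _) hx (by simp)

/-- Expanding `1 / (1 - sin θ cos θ p)` to first order splits the remainder in two. The nonlinear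
part of `p` contributes `1 - a`, with `a = ‖lam 0‖`, and the term quadratic in `p` contributes
`69/100 + 22/100 a`. -/
theorem norm_deriv_inv_sub_le {n : ℕ} {lam : Fin (n + 1) → ℂ} (hsum : ∑ i, ‖lam i‖ = 1)
    (θ : ℝ) {x : ℂ} (hx0 : x ≠ 0) (hx : ‖x‖ ≤ 9 / 10) :
    ‖-polarSlope lam θ x / x ^ 2 - lam 0 * ((Real.sin θ : ℂ) ^ 2 * Real.cos θ)‖ ≤
      ‖x‖ * ((Real.sin θ * Real.cos θ) ^ 2 * (169 / 100 - 78 / 100 * ‖lam 0‖)) := by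
  have ha1 : ‖lam 0‖ ≤ 1 := by
    rw [← hsum]
    exact Finset.single_le_sum (f := fun i => ‖lam i‖) (fun i _ => norm_nonneg _)
      (Finset.mem_univ 0)
  have hscale : IsScale lam 1 := ⟨one_pos, by simpa using hsum⟩
  have hD := polarAngular_ne_zero hscale θ (hx.trans (by norm_num))
  have hlin := norm_lienardPoly_sub_linear_le hsum
    ((norm_mul_cos_le x θ).trans (hx.trans (by norm_num)))
  have hxc : ‖x * (Real.cos θ : ℂ)‖ = ‖x‖ * |Real.cos θ| := by
    rw [norm_mul, Complex.norm_real, Real.norm_eq_abs]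
  have hcos := Real.abs_cos_le_one θ
  rw [hxc] at hlin
  set P := lienardPoly lam (x * (Real.cos θ : ℂ)) with hP
  set s := Real.sin θ with hs
  set c := Real.cos θ with hc
  set a := ‖lam 0‖ with ha
  set u := ‖x‖ with hu
  have ha0 : 0 ≤ a := norm_nonneg _
  have hu0 : 0 < u := norm_pos_iff.2 hx0
  have ht : |s * c| ≤ 1 / 2 := abs_sin_mul_cos_le θ
  have ht0 := abs_nonneg (s * c)
  -- From `(1 - a) t² + a t ≤ t (9/10 (1 - a) + a)` for `0 ≤ t ≤ 9/10`, with `t = |x cos θ|`.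
  set m := 9 / 10 + a / 10 with hm
  have hPm : ‖P‖ ≤ u * |c| * m := by
    have h1 : ‖P‖ ≤ ‖P - lam 0 * (x * c)‖ + ‖lam 0 * (x * c)‖ := by
      simpa using norm_add_le (P - lam 0 * (x * c)) (lam 0 * (x * c))
    rw [norm_mul, hxc] at h1
    have h2 : (u * |c|) * (u * |c|) ≤ (u * |c|) * (9 / 10) := by
      gcongr; nlinarith [abs_nonneg c]
    nlinarith
  have hPm' : ‖P‖ ≤ 9 / 10 * m := hPm.trans (by
    have : u * |c| ≤ 9 / 10 := by nlinarith [abs_nonneg c]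
    gcongr)
  have hDn : 1 - 9 / 20 * m ≤ ‖polarAngular lam θ x‖ := by
    have h1 : ‖(s : ℂ) * c * P‖ ≤ 1 / 2 * (9 / 10 * m) := by
      rw [norm_mul, ← Complex.ofReal_mul, Complex.norm_real, Real.norm_eq_abs]
      gcongr
    have h2 : ‖(1 : ℂ)‖ ≤ ‖(s : ℂ) * c * P‖ + ‖-polarAngular lam θ x‖ := by
      refine le_trans (le_of_eq ?_) (norm_add_le _ _)
      congr 1
      rw [polarAngular]; ring
    rw [norm_one, norm_neg] at h2
    linarith
  have e : -polarSlope lam θ x / x ^ 2 - lam 0 * ((s : ℂ) ^ 2 * c) =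
      (s : ℂ) ^ 2 * (P - lam 0 * (x * c)) / x -
        (s : ℂ) ^ 3 * c * P ^ 2 / (x * polarAngular lam θ x) := by
    have hDe : polarAngular lam θ x = -1 + s * c * P := rfl
    have hSe : polarSlope lam θ x = x * P * (s : ℂ) ^ 2 / polarAngular lam θ x := rfl
    rw [hSe]
    field_simp
    rw [hDe]
    ring
  have hm1 : m ≤ 1 := by rw [hm]; linarith
  have hDpos : 0 < 1 - 9 / 20 * m := by linarith
  have b1 : ‖(s : ℂ) ^ 2 * (P - lam 0 * (x * c)) / x‖ ≤ u * ((s * c) ^ 2 * (1 - a)) := by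
    rw [norm_div, norm_mul, norm_pow, Complex.norm_real, Real.norm_eq_abs, sq_abs,
      div_le_iff₀ hu0]
    calc s ^ 2 * ‖P - lam 0 * (x * c)‖ ≤ s ^ 2 * ((1 - a) * (u * |c|) ^ 2) := by gcongr
      _ = u * ((s * c) ^ 2 * (1 - a)) * u := by rw [mul_pow, sq_abs]; ring
  have b2 : ‖(s : ℂ) ^ 3 * c * P ^ 2 / (x * polarAngular lam θ x)‖ ≤
      u * ((s * c) ^ 2 * (69 / 100 + 22 / 100 * a)) := by
    rw [norm_div, norm_mul, norm_mul, norm_mul, norm_pow, norm_pow, Complex.norm_real,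
      Complex.norm_real, Real.norm_eq_abs, Real.norm_eq_abs,
      div_le_iff₀ (mul_pos hu0 (hDpos.trans_le hDn))]
    calc |s| ^ 3 * |c| * ‖P‖ ^ 2 ≤ |s| ^ 3 * |c| * (u * |c| * m) ^ 2 := by gcongr
      _ = u * u * (|s * c| ^ 2 * (|s * c| * m ^ 2)) := by rw [abs_mul]; ring
      _ ≤ u * u * (|s * c| ^ 2 * (1 / 2 * m ^ 2)) := by gcongr
      -- The linear function of `a` is an upper bound on `[0, 1]` for `m² / 2` divided by `1 - 9/20
      -- m`.
      _ ≤ u * u * (|s * c| ^ 2 * ((69 / 100 + 22 / 100 * a) * (1 - 9 / 20 * m))) := by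
        gcongr u * u * (|s * c| ^ 2 * ?_)
        rw [hm]
        nlinarith [mul_nonneg ha0 (sub_nonneg.2 ha1)]
      _ = u * ((s * c) ^ 2 * (69 / 100 + 22 / 100 * a)) * (u * (1 - 9 / 20 * m)) := by
        rw [sq_abs]; ring
      _ ≤ _ := by gcongr
  rw [e]
  refine (norm_sub_le _ _).trans ((add_le_add b1 b2).trans (le_of_eq ?_))
  ring

theorem radius_margin {a : ℝ} (ha0 : 0 ≤ a) (ha1 : a ≤ 1) :
    (10 / 9 + a / 3) ^ 2 ≤
      4 - 2 * (1 + 3 / 10 * a) * (169 / 100 - 78 / 100 * a) * (Real.pi / 4) := by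
  have hpi := Real.pi_lt_d4
  have h0 : 0 ≤ (1 + 3 / 10 * a) * (169 / 100 - 78 / 100 * a) :=
    mul_nonneg (by linarith) (by linarith)
  have h1 : (1 + 3 / 10 * a) * (169 / 100 - 78 / 100 * a) * Real.pi ≤
      (1 + 3 / 10 * a) * (169 / 100 - 78 / 100 * a) * 3.1416 := by gcongr
  -- The difference of the two sides is a convex quadratic in `a`, positive but small at its vertex
  -- near `0.608`.
  nlinarith [sq_nonneg (a - 608 / 1000)]

/-- The a priori estimate: the weak bound `9/10` on the whole interval becomes strict at its left
end, because `|V|²` loses at most `C π / 4` from a value above `4`. -/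
theorem norm_lt_of_polar_solution {n : ℕ} {lam : Fin (n + 1) → ℂ} (hsum : ∑ i, ‖lam i‖ = 1)
    {r : ℝ → ℂ} {θ₀ : ℝ} (h0 : 0 ≤ θ₀) (h1 : θ₀ ≤ 2 * Real.pi)
    (hr : ∀ θ ∈ Icc θ₀ (2 * Real.pi), ‖r θ‖ ≤ 9 / 10 ∧
      HasDerivWithinAt r (polarSlope lam θ (r θ)) (Icc θ₀ (2 * Real.pi)) θ)
    (hend : ‖r (2 * Real.pi)‖ < 1 / 2) : ‖r θ₀‖ < 9 / 10 := by
  have hscale : IsScale lam 1 := ⟨one_pos, by simpa using hsum⟩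
  have ha1 : ‖lam 0‖ ≤ 1 := by
    rw [← hsum]
    exact Finset.single_le_sum (f := fun i => ‖lam i‖) (fun i _ => norm_nonneg _)
      (Finset.mem_univ 0)
  have ha0 := norm_nonneg (lam 0)
  have hle1 : ∀ θ ∈ Icc θ₀ (2 * Real.pi), ‖r θ‖ ≤ 1 := fun θ hθ => (hr θ hθ).1.trans (by norm_num)
  have hrc : ContinuousOn r (Icc θ₀ (2 * Real.pi)) := fun θ hθ => (hr θ hθ).2.continuousWithinAt
  have hlin : ∀ θ ∈ Icc θ₀ (2 * Real.pi), HasDerivWithinAt r (polarQuot lam θ (r θ) 0 * r θ)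
      (Icc θ₀ (2 * Real.pi)) θ := fun θ hθ => by
    have := polarSlope_sub lam θ (polarAngular_ne_zero hscale θ (hle1 θ hθ))
      (polarAngular_ne_zero hscale θ (x := 0) (by simp))
    rw [polarSlope_zero, sub_zero, sub_zero] at this
    rw [← this]
    exact (hr θ hθ).2
  have hA : ContinuousOn (fun θ => polarQuot lam θ (r θ) 0) (Icc θ₀ (2 * Real.pi)) :=
    (continuousOn_polarQuot hscale).comp (f := fun θ => (θ, r θ, (0 : ℂ)))
      (by fun_prop) fun θ hθ => ⟨hle1 θ hθ, by simp⟩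
  have hexp := fun θ (hθ : θ ∈ Icc θ₀ (2 * Real.pi)) =>
    eq_mul_exp_of_hasDerivWithinAt_mul h1 hA hlin hθ
  -- A solution is either identically zero or nowhere zero; in the second case `1/r` may be used.
  by_cases hz : r (2 * Real.pi) = 0
  · rw [hexp θ₀ (left_mem_Icc.2 h1), hz]; norm_num
  have hne : ∀ θ ∈ Icc θ₀ (2 * Real.pi), r θ ≠ 0 := fun θ hθ => by
    rw [hexp θ hθ]; exact mul_ne_zero hz (Complex.exp_ne_zero _)
  set V : ℝ → ℂ := fun θ => (r θ)⁻¹ - lam 0 * ((Real.sin θ : ℂ) ^ 3 / 3) with hV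
  have hVd : ∀ θ ∈ Icc θ₀ (2 * Real.pi), HasDerivWithinAt V (-polarSlope lam θ (r θ) / r θ ^ 2 -
      lam 0 * ((Real.sin θ : ℂ) ^ 2 * Real.cos θ)) (Icc θ₀ (2 * Real.pi)) θ := fun θ hθ => by
    have hs : HasDerivAt (fun θ : ℝ => lam 0 * ((Real.sin θ : ℂ) ^ 3 / 3))
        (lam 0 * ((Real.sin θ : ℂ) ^ 2 * Real.cos θ)) θ := by
      refine ((((Real.hasDerivAt_sin θ).ofReal_comp.pow 3).div_const 3).const_mul
        (lam 0)).congr_deriv ?_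
      push_cast; ring
    exact ((hr θ hθ).2.inv (hne θ hθ)).sub hs.hasDerivWithinAt
  set C := 2 * (1 + 3 / 10 * ‖lam 0‖) * (169 / 100 - 78 / 100 * ‖lam 0‖) with hC
  have hC0 : 0 ≤ C := mul_nonneg (by linarith) (by linarith)
  -- A primitive of `C (sin θ cos θ)²`, the bound for the derivative of `V²`. Squaring `V` is what
  -- absorbs the factor `‖r‖` in the estimate of `V'`.
  set φ : ℝ → ℝ := fun θ => C * (θ / 8 - Real.sin (4 * θ) / 32) with hφ
  have hφd : ∀ θ, HasDerivAt φ (C * (Real.sin θ * Real.cos θ) ^ 2) θ := fun θ => by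
    have h4 : HasDerivAt (fun θ : ℝ => Real.sin (4 * θ)) (Real.cos (4 * θ) * (4 * 1)) θ :=
      ((hasDerivAt_id θ).const_mul 4).sin
    refine ((((hasDerivAt_id θ).div_const 8).sub (h4.div_const 32)).const_mul C).congr_deriv ?_
    have e1 : Real.cos (4 * θ) = 1 - 8 * (Real.sin θ * Real.cos θ) ^ 2 := by
      rw [show 4 * θ = 2 * (2 * θ) by ring, Real.cos_two_mul, Real.cos_two_mul]
      have := Real.sin_sq θ
      rw [mul_pow, this]; ring
    rw [e1]; ring
  have hrs : ∀ θ : ℝ, ‖lam 0 * ((Real.sin θ : ℂ) ^ 3 / 3)‖ ≤ ‖lam 0‖ / 3 := fun θ => by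
    rw [norm_mul, norm_div, norm_pow, Complex.norm_real, Real.norm_eq_abs]
    have : |Real.sin θ| ^ 3 ≤ 1 := pow_le_one₀ (abs_nonneg _) (Real.abs_sin_le_one θ)
    have h3 : ‖(3 : ℂ)‖ = 3 := by norm_num
    rw [h3, div_eq_mul_inv ‖lam 0‖]
    gcongr
    linarith
  have hfence := image_norm_le_of_norm_deriv_right_le_deriv_boundary
    (f := fun θ => V θ ^ 2 - V θ₀ ^ 2) (B := fun θ => φ θ - φ θ₀)
    (f' := fun θ => 2 * V θ * (-polarSlope lam θ (r θ) / r θ ^ 2 -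
      lam 0 * ((Real.sin θ : ℂ) ^ 2 * Real.cos θ)))
    (a := θ₀) (b := 2 * Real.pi)
    (fun θ hθ => (((hVd θ hθ).continuousWithinAt.pow 2).sub continuousWithinAt_const))
    (fun θ hθ => by
      have hmem : Icc θ₀ (2 * Real.pi) ∈ nhdsWithin θ (Ici θ) :=
        Filter.mem_of_superset (Icc_mem_nhdsGE hθ.2) (Icc_subset_Icc_left hθ.1)
      have := (((hVd θ ⟨hθ.1, hθ.2.le⟩).pow 2).sub_const (V θ₀ ^ 2)).mono_of_mem_nhdsWithin hmem
      refine this.congr_deriv ?_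
      push_cast; ring)
    (by simp) (fun θ => (hφd θ).sub_const _)
    (fun θ hθ => by
      have hθ' : θ ∈ Icc θ₀ (2 * Real.pi) := ⟨hθ.1, hθ.2.le⟩
      have hb := norm_deriv_inv_sub_le hsum θ (hne θ hθ') (hr θ hθ').1
      have hVr : ‖V θ‖ * ‖r θ‖ ≤ 1 + 3 / 10 * ‖lam 0‖ := by
        have hpos := norm_pos_iff.2 (hne θ hθ')
        have : ‖V θ‖ ≤ ‖r θ‖⁻¹ + ‖lam 0‖ / 3 := by
          refine (norm_sub_le _ _).trans ?_
          rw [norm_inv]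
          exact add_le_add_right (hrs θ) _
        calc ‖V θ‖ * ‖r θ‖ ≤ (‖r θ‖⁻¹ + ‖lam 0‖ / 3) * ‖r θ‖ := by gcongr
          _ = 1 + ‖lam 0‖ / 3 * ‖r θ‖ := by field_simp
          _ ≤ 1 + ‖lam 0‖ / 3 * (9 / 10) := by have := (hr θ hθ').1; gcongr
          _ = _ := by ring
      rw [norm_mul, norm_mul, Complex.norm_ofNat]
      have hK : 0 ≤ (Real.sin θ * Real.cos θ) ^ 2 * (169 / 100 - 78 / 100 * ‖lam 0‖) :=
        mul_nonneg (sq_nonneg _) (by linarith)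
      calc _ ≤ 2 * ‖V θ‖ * (‖r θ‖ * ((Real.sin θ * Real.cos θ) ^ 2 *
            (169 / 100 - 78 / 100 * ‖lam 0‖))) := by gcongr
        _ = 2 * (‖V θ‖ * ‖r θ‖) * ((Real.sin θ * Real.cos θ) ^ 2 *
            (169 / 100 - 78 / 100 * ‖lam 0‖)) := by ring
        _ ≤ 2 * (1 + 3 / 10 * ‖lam 0‖) * ((Real.sin θ * Real.cos θ) ^ 2 *
            (169 / 100 - 78 / 100 * ‖lam 0‖)) := by gcongr
        _ = _ := by rw [hC]; ring)
    (right_mem_Icc.2 h1)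
  have hφ1 : φ (2 * Real.pi) - φ θ₀ ≤ C * (Real.pi / 4) := by
    have e1 : Real.sin (4 * (2 * Real.pi)) = 0 := by
      rw [show 4 * (2 * Real.pi) = (8 : ℕ) * Real.pi by push_cast; ring, Real.sin_nat_mul_pi]
    have e2 : Real.sin (4 * θ₀) ≤ 4 * θ₀ := Real.sin_le (by linarith)
    have e3 : 0 ≤ C * (θ₀ / 8 - Real.sin (4 * θ₀) / 32) := mul_nonneg hC0 (by linarith)
    simp only [hφ, e1]
    linarith
  have hVend : 4 < ‖V (2 * Real.pi)‖ ^ 2 := by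
    have e1 : V (2 * Real.pi) = (r (2 * Real.pi))⁻¹ := by simp [hV]
    have e2 : 2 < ‖r (2 * Real.pi)‖⁻¹ := by
      rw [lt_inv_comm₀ two_pos (norm_pos_iff.2 hz)]; linarith
    rw [e1, norm_inv]; nlinarith
  have hV0 : (10 / 9 + ‖lam 0‖ / 3) ^ 2 < ‖V θ₀‖ ^ 2 := by
    have := norm_sub_norm_le (V (2 * Real.pi) ^ 2) (V θ₀ ^ 2)
    simp only [norm_pow] at this
    have hm := radius_margin ha0 ha1
    rw [← hC] at hm
    linarith
  have hV0' : 10 / 9 + ‖lam 0‖ / 3 < ‖V θ₀‖ := lt_of_pow_lt_pow_left₀ 2 (norm_nonneg _) hV0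
  have hfin : ‖V θ₀‖ ≤ ‖r θ₀‖⁻¹ + ‖lam 0‖ / 3 := by
    refine (norm_sub_le _ _).trans ?_
    rw [norm_inv]
    exact add_le_add_right (hrs θ₀) _
  have hlt : 10 / 9 < ‖r θ₀‖⁻¹ := by linarith
  rw [lt_inv_comm₀ (by norm_num) (norm_pos_iff.2 (hne θ₀ (left_mem_Icc.2 h1)))] at hlt
  linarith

/-! ### Existence and holomorphy of the return mapping -/

/-- `r` solves the polar equation on `[0, 2π]` and stays in the closed disc of radius `ρ`. -/
def IsPolarSolution {d : ℕ} (lam : Fin d → ℂ) (ρ : ℝ) (r : ℝ → ℂ) : Prop :=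
  ∀ θ ∈ Icc 0 (2 * Real.pi), ‖r θ‖ ≤ ρ ∧
    HasDerivWithinAt r (polarSlope lam θ (r θ)) (Icc 0 (2 * Real.pi)) θ

theorem IsPolarSolution.continuousOn {d : ℕ} {lam : Fin d → ℂ} {ρ : ℝ} {r : ℝ → ℂ}
    (hr : IsPolarSolution lam ρ r) : ContinuousOn r (Icc 0 (2 * Real.pi)) :=
  fun θ hθ => (hr θ hθ).2.continuousWithinAt

theorem IsPolarSolution.isReturn {d : ℕ} {lam : Fin d → ℂ} {ρ : ℝ} {r : ℝ → ℂ}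
    (h : IsScale lam ρ) (hr : IsPolarSolution lam ρ r) :
    IsReturn lam (r (2 * Real.pi)) (r 0) :=
  ⟨r, rfl, rfl, fun θ hθ => ⟨polarAngular_ne_zero h θ (hr θ hθ).1, (hr θ hθ).2⟩⟩

theorem exists_isPolarSolution_of_sum_eq_one {n : ℕ} {lam : Fin (n + 1) → ℂ}
    (hsum : ∑ i, ‖lam i‖ = 1) {z : ℂ} (hz : ‖z‖ < 1 / 2) :
    ∃ r, IsPolarSolution lam 1 r ∧ r (2 * Real.pi) = z := by
  have hscale : IsScale lam 1 := ⟨one_pos, by simpa using hsum⟩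
  obtain ⟨r, hrz, hr⟩ := exists_truncated_solution hscale z
  have hpi := Real.pi_pos
  have hrc : ContinuousOn r (Icc 0 (2 * Real.pi)) := fun θ hθ => (hr θ hθ).continuousWithinAt
  have hclamp : ∀ θ, ‖r θ‖ ≤ 9 / 10 → clampNorm 1 (r θ) = r θ := fun θ h =>
    clampNorm_of_le one_pos (h.trans (by norm_num))
  have hcross : ∀ θ ∈ Icc 0 (2 * Real.pi), 9 / 10 ≤ ‖r θ‖ →
      ∃ η ∈ Icc θ (2 * Real.pi), ‖r η‖ = 9 / 10 := fun θ hθ h => by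
    have := intermediate_value_Icc' hθ.2 (hrc.norm.mono (Icc_subset_Icc_left hθ.1))
    exact this ⟨by rw [hrz]; linarith, h⟩
  have hlt : ∀ θ ∈ Icc 0 (2 * Real.pi), ‖r θ‖ < 9 / 10 := by
    by_contra! hcon
    obtain ⟨θ, hθ, hge⟩ := hcon
    have hcpt : IsCompact (Icc 0 (2 * Real.pi) ∩ (fun θ => ‖r θ‖) ⁻¹' {9 / 10}) :=
      isCompact_Icc.of_isClosed_subset
        (hrc.norm.preimage_isClosed_of_isClosed isClosed_Icc isClosed_singleton)
        inter_subset_left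
    obtain ⟨η, hη, hη'⟩ := hcross θ hθ hge
    -- Time runs down from `2π`, so the greatest crossing is the first one; to its right the
    -- truncation is inactive and the a priori estimate applies.
    obtain ⟨θ₀, ⟨hθ₀, hθ₀'⟩, hmax⟩ := hcpt.exists_isGreatest ⟨η, ⟨hθ.1.trans hη.1, hη.2⟩, hη'⟩
    have hle : ∀ θ ∈ Icc θ₀ (2 * Real.pi), ‖r θ‖ ≤ 9 / 10 := fun θ hθ => by
      by_contra! hgt
      obtain ⟨η, hη, hη'⟩ := hcross θ ⟨hθ₀.1.trans hθ.1, hθ.2⟩ hgt.le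
      have h1 : η ≤ θ₀ := hmax ⟨⟨hθ₀.1.trans (hθ.1.trans hη.1), hη.2⟩, hη'⟩
      have h2 : θ = θ₀ := le_antisymm (hη.1.trans h1) hθ.1
      rw [h2] at hgt
      exact hgt.ne' hθ₀'
    refine (norm_lt_of_polar_solution hsum hθ₀.1 hθ₀.2 (fun θ hθ => ⟨hle θ hθ, ?_⟩)
      (by rwa [hrz])).ne hθ₀'
    have := (hr θ ⟨hθ₀.1.trans hθ.1, hθ.2⟩).mono (Icc_subset_Icc_left hθ₀.1)
    rwa [hclamp θ (hle θ hθ)] at this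
  refine ⟨r, fun θ hθ => ⟨(hlt θ hθ).le.trans (by norm_num), ?_⟩, hrz⟩
  have := hr θ hθ
  rwa [hclamp θ (hlt θ hθ).le] at this

/-! ### Rescaling to `ρ = 1` -/

theorem lienardPoly_mul {d : ℕ} (lam : Fin d → ℂ) (k x : ℂ) :
    lienardPoly lam (k * x) = lienardPoly (fun i => lam i * k ^ (i.val + 1)) x := by
  simp only [lienardPoly, mul_pow, mul_assoc]

theorem polarAngular_mul {d : ℕ} (lam : Fin d → ℂ) (θ : ℝ) (k x : ℂ) :
    polarAngular lam θ (k * x) = polarAngular (fun i => lam i * k ^ (i.val + 1)) θ x := by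
  rw [polarAngular, polarAngular, mul_assoc k, lienardPoly_mul]

theorem polarSlope_mul {d : ℕ} (lam : Fin d → ℂ) (θ : ℝ) (k x : ℂ) :
    polarSlope lam θ (k * x) = k * polarSlope (fun i => lam i * k ^ (i.val + 1)) θ x := by
  rw [polarSlope, polarSlope, polarAngular_mul, mul_assoc k x (Real.cos θ : ℂ), lienardPoly_mul]
  ring

theorem exists_isPolarSolution {d : ℕ} {lam : Fin d → ℂ} {ρ : ℝ} (h : IsScale lam ρ) {z : ℂ}
    (hz : ‖z‖ < ρ / 2) : ∃ r, IsPolarSolution lam ρ r ∧ r (2 * Real.pi) = z := by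
  have hρ := h.1
  have hρ' : (ρ : ℂ) ≠ 0 := by exact_mod_cast hρ.ne'
  have hρn : ‖(ρ : ℂ)‖ = ρ := by rw [Complex.norm_real, Real.norm_eq_abs, abs_of_pos hρ]
  cases d with
  -- An empty sum cannot equal `1`.
  | zero => simp [IsScale] at h
  | succ n =>
    obtain ⟨r, hr, hrz⟩ := exists_isPolarSolution_of_sum_eq_one
      (lam := fun i => lam i * (ρ : ℂ) ^ (i.val + 1)) (z := z / ρ)
      (by rw [← h.2]; simp only [norm_mul, norm_pow, hρn, mul_comm])
      (by rw [norm_div, hρn, div_lt_iff₀ hρ]; linarith)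
    refine ⟨fun θ => ρ * r θ, fun θ hθ => ⟨?_, ?_⟩, ?_⟩
    · rw [norm_mul, hρn]
      exact mul_le_of_le_one_right hρ.le (hr θ hθ).1
    · rw [polarSlope_mul]
      exact (hr θ hθ).2.const_mul _
    · simp only [hrz]; field_simp

theorem IsPolarSolution.sub_eq {d : ℕ} {lam : Fin d → ℂ} {ρ : ℝ} (h : IsScale lam ρ)
    {r q : ℝ → ℂ} (hr : IsPolarSolution lam ρ r) (hq : IsPolarSolution lam ρ q) {θ : ℝ}
    (hθ : θ ∈ Icc 0 (2 * Real.pi)) :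
    r θ - q θ = (r (2 * Real.pi) - q (2 * Real.pi)) *
      Complex.exp (∫ s in (2 * Real.pi)..θ, polarQuot lam s (r s) (q s)) := by
  refine eq_mul_exp_of_hasDerivWithinAt_mul (f := fun θ => r θ - q θ) (by positivity)
    ((continuousOn_polarQuot h).comp (f := fun θ => (θ, r θ, q θ))
      (continuousOn_id.prodMk (hr.continuousOn.prodMk hq.continuousOn))
      fun θ hθ => ⟨(hr θ hθ).1, (hq θ hθ).1⟩) (fun t ht => ?_) hθ
  change HasDerivWithinAt _ (polarQuot lam t (r t) (q t) * (r t - q t)) _ _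
  rw [← polarSlope_sub lam t (polarAngular_ne_zero h t (hr t ht).1)
    (polarAngular_ne_zero h t (hq t ht).1)]
  exact (hr t ht).2.sub (hq t ht).2

/-- The difference quotient of the return mapping is exactly the exponential of an integral of
`polarQuot`. Solutions depend on their end value in a Lipschitz way, with constant `exp (2π M)`, so
dominated convergence gives the limit. -/
theorem hasDerivAt_polar_return {d : ℕ} {lam : Fin d → ℂ} {ρ : ℝ} (h : IsScale lam ρ)
    {r : ℂ → ℝ → ℂ} (hr : ∀ z, ‖z‖ < ρ / 2 → IsPolarSolution lam ρ (r z) ∧ r z (2 * Real.pi) = z)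
    {z : ℂ} (hz : ‖z‖ < ρ / 2) :
    HasDerivAt (fun z => r z 0)
      (Complex.exp (∫ s in (2 * Real.pi)..0, polarQuot lam s (r z s) (r z s))) z := by
  obtain ⟨M, hM0, hM⟩ := exists_norm_polarQuot_le h
  have hpi := Real.pi_pos
  have h0 : (0 : ℝ) ∈ Icc 0 (2 * Real.pi) := left_mem_Icc.2 (by positivity)
  have hev : ∀ᶠ w in nhds z, ‖w‖ < ρ / 2 := continuous_norm.continuousAt.eventually_lt_const hz
  have hmem : ∀ s ∈ uIoc (2 * Real.pi) 0, s ∈ Icc 0 (2 * Real.pi) := fun s hs => by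
    rw [uIoc_of_ge (by positivity)] at hs; exact Ioc_subset_Icc_self hs
  have hquot : ∀ w, ‖w‖ < ρ / 2 →
      ContinuousOn (fun s => polarQuot lam s (r w s) (r z s)) (Icc 0 (2 * Real.pi)) := fun w hw =>
    (continuousOn_polarQuot h).comp (f := fun θ => (θ, r w θ, r z θ))
      (continuousOn_id.prodMk ((hr w hw).1.continuousOn.prodMk (hr z hz).1.continuousOn))
      fun θ hθ => ⟨((hr w hw).1 θ hθ).1, ((hr z hz).1 θ hθ).1⟩
  have hlim : ∀ s ∈ Icc 0 (2 * Real.pi), Filter.Tendsto (fun w => r w s) (nhds z)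
      (nhds (r z s)) := fun s hs => by
    rw [tendsto_iff_norm_sub_tendsto_zero]
    have hsq : Filter.Tendsto (fun w => ‖w - z‖ * Real.exp (M * (2 * Real.pi))) (nhds z)
        (nhds 0) := by
      have : Continuous fun w : ℂ => ‖w - z‖ * Real.exp (M * (2 * Real.pi)) := by fun_prop
      simpa using this.tendsto z
    refine squeeze_zero' (Filter.Eventually.of_forall fun _ => norm_nonneg _) ?_ hsq
    filter_upwards [hev] with w hw
    rw [(hr w hw).1.sub_eq h (hr z hz).1 hs, (hr w hw).2, (hr z hz).2, norm_mul]
    gcongr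
    refine (Complex.norm_exp_le_exp_norm _).trans (Real.exp_le_exp.2 ?_)
    refine (intervalIntegral.norm_integral_le_of_norm_le_const (C := M) fun t ht => ?_).trans ?_
    · rw [uIoc_of_ge hs.2] at ht
      have ht' : t ∈ Icc 0 (2 * Real.pi) := ⟨hs.1.trans ht.1.le, ht.2⟩
      exact hM t ht' _ _ ((hr w hw).1 t ht').1 ((hr z hz).1 t ht').1
    · gcongr
      rw [abs_le]; constructor <;> linarith [hs.1, hs.2]
  rw [hasDerivAt_iff_tendsto_slope]
  have hint : Filter.Tendsto
      (fun w => Complex.exp (∫ s in (2 * Real.pi)..0, polarQuot lam s (r w s) (r z s)))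
      (nhdsWithin z {z}ᶜ)
      (nhds (Complex.exp (∫ s in (2 * Real.pi)..0, polarQuot lam s (r z s) (r z s)))) := by
    refine ((Complex.continuous_exp.tendsto _).comp ?_).mono_left nhdsWithin_le_nhds
    refine intervalIntegral.tendsto_integral_filter_of_dominated_convergence (fun _ => M) ?_ ?_
      intervalIntegrable_const ?_
    · filter_upwards [hev] with w hw
      exact ((hquot w hw).mono hmem).aestronglyMeasurable measurableSet_uIoc
    · filter_upwards [hev] with w hw
      exact Filter.Eventually.of_forall fun s hs => hM s (hmem s hs) _ _
        ((hr w hw).1 s (hmem s hs)).1 ((hr z hz).1 s (hmem s hs)).1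
    · refine Filter.Eventually.of_forall fun s hs => ?_
      have hc := continuousOn_polarQuot h (s, r z s, r z s)
        ⟨((hr z hz).1 s (hmem s hs)).1, ((hr z hz).1 s (hmem s hs)).1⟩
      refine hc.tendsto.comp (f := fun w => (s, r w s, r z s)) (tendsto_nhdsWithin_iff.2 ⟨?_, ?_⟩)
      · exact tendsto_const_nhds.prodMk_nhds
          ((hlim s (hmem s hs)).prodMk_nhds tendsto_const_nhds)
      · filter_upwards [hev] with w hw
        exact ⟨((hr w hw).1 s (hmem s hs)).1, ((hr z hz).1 s (hmem s hs)).1⟩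
  refine hint.congr' ?_
  filter_upwards [nhdsWithin_le_nhds hev, self_mem_nhdsWithin] with w hw hne
  have hwz : w - z ≠ 0 := sub_ne_zero.2 hne
  rw [slope_def_field, (hr w hw).1.sub_eq h (hr z hz).1 h0, (hr w hw).2, (hr z hz).2,
    mul_div_cancel_left₀ _ hwz]

theorem exists_powerSeries_polar_return {d : ℕ} {lam : Fin d → ℂ} {ρ : ℝ} (h : IsScale lam ρ) :
    ∃ a : ℕ → ℂ, ∀ z : ℂ, ‖z‖ < ρ / 2 → ∃ r, IsPolarSolution lam ρ r ∧ r (2 * Real.pi) = z ∧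
      HasSum (fun k : ℕ => a k * z ^ k) (r 0) := by
  choose! r hr using fun z (hz : ‖z‖ < ρ / 2) => exists_isPolarSolution h hz
  have hd : DifferentiableOn ℂ (fun z => r z 0) (Metric.ball 0 (ρ / 2)) := fun z hz =>
    (hasDerivAt_polar_return h hr (by simpa using hz)).differentiableAt.differentiableWithinAt
  refine ⟨fun k => (k.factorial : ℂ)⁻¹ * iteratedDeriv k (fun z => r z 0) 0, fun z hz =>
    ⟨r z, (hr z hz).1, (hr z hz).2, ?_⟩⟩
  have := Complex.hasSum_taylorSeries_on_ball hd (z := z) (by simpa using hz)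
  simp only [sub_zero, smul_eq_mul] at this
  have e : ∀ k : ℕ, (k.factorial : ℂ)⁻¹ * iteratedDeriv k (fun z => r z 0) 0 * z ^ k =
      (k.factorial : ℂ)⁻¹ * (z ^ k * iteratedDeriv k (fun z => r z 0) 0) := fun k => by ring
  simpa only [e] using this

/-! ### Real parameters: from the polar equation to the flow -/

/-- Time is recovered from the angle by integrating `1 / ω`. The orbit runs through the angles
strictly between `2π` and `0`, where the `x`-axis is met only at `π`, on the negative side. -/
theorem isFirstReturn_of_polar {d : ℕ} {mu : Fin d → ℝ} {R ω : ℝ → ℝ}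
    (hω : ∀ θ, ω θ = 1 - Real.sin θ * Real.cos θ * lienardPoly mu (R θ * Real.cos θ))
    (hR : ∀ θ ∈ Icc 0 (2 * Real.pi), 0 < R θ ∧ 0 < ω θ ∧ ω θ ≤ 2 ∧
      HasDerivWithinAt R (-(R θ * lienardPoly mu (R θ * Real.cos θ) * Real.sin θ ^ 2 / ω θ))
        (Icc 0 (2 * Real.pi)) θ) :
    IsFirstReturn mu (R (2 * Real.pi)) (R 0) := by
  have hpi := Real.pi_pos
  have h2pi : (0 : ℝ) ≤ 2 * Real.pi := by positivity
  have h0 := left_mem_Icc.2 h2pi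
  have h1 := right_mem_Icc.2 h2pi
  have hRc : ContinuousOn R (Icc 0 (2 * Real.pi)) := fun θ hθ => (hR θ hθ).2.2.2.continuousWithinAt
  have hωc : ContinuousOn ω (Icc 0 (2 * Real.pi)) := by
    rw [show ω = _ from funext hω]
    unfold lienardPoly
    fun_prop
  have hgc : ContinuousOn (fun θ => (ω θ)⁻¹) (Icc 0 (2 * Real.pi)) :=
    hωc.inv₀ fun θ hθ => (hR θ hθ).2.1.ne'
  -- Extended by constants, `1 / ω` stays at least `1/2`, so its primitive `T` is an increasing
  -- bijection of the line with a differentiable inverse.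
  set G : ℝ → ℝ := IccExtend h2pi ((Icc 0 (2 * Real.pi)).domRestrict fun θ => (ω θ)⁻¹) with hG
  have hGc : Continuous G := (continuousOn_iff_continuous_domRestrict.1 hgc).Icc_extend'
  have hGω : ∀ θ ∈ Icc 0 (2 * Real.pi), G θ = (ω θ)⁻¹ := fun θ hθ => by
    rw [hG, IccExtend_of_mem h2pi _ hθ]; rfl
  have hGpos : ∀ θ, 1 / 2 ≤ G θ := fun θ => by
    obtain ⟨η, hη⟩ : ∃ η : Icc 0 (2 * Real.pi), G θ = (ω η)⁻¹ := ⟨projIcc _ _ h2pi θ, rfl⟩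
    have := hR η η.2
    rw [hη, one_div]
    exact inv_anti₀ this.2.1 this.2.2.1
  set T : ℝ → ℝ := fun θ => ∫ s in (0 : ℝ)..θ, G s with hT
  have hTd : ∀ θ, HasDerivAt T (G θ) θ := fun θ =>
    (hGc.integral_hasStrictDerivAt 0 θ).hasDerivAt
  have hTc : Continuous T := continuous_iff_continuousAt.2 fun θ => (hTd θ).continuousAt
  have hT0 : T 0 = 0 := by simp [hT]
  have hTmono : StrictMono T := strictMono_of_deriv_pos fun θ => by
    rw [(hTd θ).deriv]; linarith [hGpos θ]
  have hTlin : Monotone fun θ => T θ - 1 / 2 * θ := by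
    have hd : ∀ θ, HasDerivAt (fun θ => T θ - 1 / 2 * θ) (G θ - 1 / 2 * 1) θ := fun θ =>
      (hTd θ).sub ((hasDerivAt_id θ).const_mul _)
    refine monotone_of_deriv_nonneg (fun θ => (hd θ).differentiableAt) fun θ => ?_
    rw [(hd θ).deriv]; linarith [hGpos θ]
  have hTsurj : Function.Surjective T := by
    refine hTc.surjective ?_ ?_
    · refine Filter.tendsto_atTop_mono' _ ?_
        (Filter.tendsto_id.const_mul_atTop (show (0 : ℝ) < 1 / 2 by norm_num))
      filter_upwards [Filter.eventually_ge_atTop 0] with θ hθ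
      have := hTlin hθ
      simp only [hT0, mul_zero, sub_zero, id] at this ⊢
      linarith
    · refine Filter.tendsto_atBot_mono' _ ?_
        (Filter.tendsto_id.const_mul_atBot (show (0 : ℝ) < 1 / 2 by norm_num))
      filter_upwards [Filter.eventually_le_atBot 0] with θ hθ
      have := hTlin hθ
      simp only [hT0, mul_zero, sub_zero, id] at this ⊢
      linarith
  set e : ℝ ≃o ℝ := hTmono.orderIsoOfSurjective T hTsurj with he
  have heT : ∀ u, T (e.symm u) = u := fun u => e.apply_symm_apply u
  have heT' : ∀ θ, e.symm (T θ) = θ := fun θ => e.symm_apply_apply θ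
  have hed : ∀ u, HasDerivAt (fun u => e.symm u) (G (e.symm u))⁻¹ u := fun u =>
    HasDerivAt.of_local_left_inverse e.symm.continuous.continuousAt (hTd _)
      (by linarith [hGpos (e.symm u)] : (0 : ℝ) < G (e.symm u)).ne'
      (Filter.Eventually.of_forall heT)
  set S := T (2 * Real.pi) with hS
  have hS0 : 0 < S := by rw [← hT0]; exact hTmono (by positivity)
  -- The shift by the total time `S` and the sign reflect that the angle decreases from `2π` to `0`.
  set ϑ : ℝ → ℝ := fun t => e.symm (S - t) with hϑ
  have hϑ0 : ϑ 0 = 2 * Real.pi := by simp only [hϑ, sub_zero, hS, heT']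
  have hϑS : ϑ S = 0 := by
    have := heT' 0
    rw [hT0] at this
    simpa only [hϑ, sub_self] using this
  have hϑanti : StrictAnti ϑ := fun s t hst => e.symm.strictMono (by linarith)
  have hmaps : MapsTo ϑ (Icc 0 S) (Icc 0 (2 * Real.pi)) := fun t ht =>
    ⟨hϑS ▸ hϑanti.antitone ht.2, hϑ0 ▸ hϑanti.antitone ht.1⟩
  have hϑd : ∀ t ∈ Icc 0 S, HasDerivWithinAt ϑ (-ω (ϑ t)) (Icc 0 S) t := fun t ht => by
    have := (hed (S - t)).comp t ((hasDerivAt_id t).const_sub S)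
    refine (this.congr_deriv ?_).hasDerivWithinAt
    change (G (ϑ t))⁻¹ * -1 = _
    rw [hGω _ (hmaps ht), inv_inv, mul_neg_one]
  refine ⟨(hR _ h1).1, (hR _ h0).1, S, hS0,
    fun t => (R (ϑ t) * Real.cos (ϑ t), R (ϑ t) * Real.sin (ϑ t)), fun t ht => ?_, ?_, ?_, ?_⟩
  · obtain ⟨-, hωp, -, hRd⟩ := hR (ϑ t) (hmaps ht)
    have hRϑ := hRd.comp t (hϑd t ht) hmaps
    have hc := (hRϑ.mul (hϑd t ht).cos)
    have hs := (hRϑ.mul (hϑd t ht).sin)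
    refine (hc.prodMk hs).congr_deriv ?_
    have hω' := hω (ϑ t)
    have hsc := Real.sin_sq_add_cos_sq (ϑ t)
    simp only [lienardField, Function.comp_apply]
    generalize lienardPoly mu (R (ϑ t) * Real.cos (ϑ t)) = p at *
    have hq : -(R (ϑ t) * p * Real.sin (ϑ t) ^ 2 / ω (ϑ t)) * -ω (ϑ t) =
        R (ϑ t) * p * Real.sin (ϑ t) ^ 2 := by
      have := hωp.ne'
      field_simp
    rw [hq]
    ext
    · simp only
      rw [hω']; ring
    · simp only
      rw [hω']
      linear_combination (R (ϑ t) * p * Real.sin (ϑ t)) * hsc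
  · simp [hϑ0]
  · simp [hϑS]
  · rintro t ht ⟨hx, hy⟩
    have hl : 0 < ϑ t := hϑS ▸ hϑanti ht.2
    have hu : ϑ t < 2 * Real.pi := hϑ0 ▸ hϑanti ht.1
    have hRp := (hR (ϑ t) ⟨hl.le, hu.le⟩).1
    have hcos : 0 < Real.cos (ϑ t) := (mul_pos_iff_of_pos_left hRp).1 hx
    have hsin : Real.sin (ϑ t) = 0 := (mul_eq_zero.1 hy).resolve_left hRp.ne'
    have hpi' : Real.sin (ϑ t - Real.pi) = 0 := by rw [Real.sin_sub_pi, hsin, neg_zero]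
    rw [Real.sin_eq_zero_iff_of_lt_of_lt (by linarith) (by linarith)] at hpi'
    rw [show ϑ t = Real.pi by linarith, Real.cos_pi] at hcos
    linarith

theorem ofReal_lienardPoly {d : ℕ} (mu : Fin d → ℝ) (x : ℝ) :
    ((lienardPoly mu x : ℝ) : ℂ) = lienardPoly (fun i => (mu i : ℂ)) (x : ℂ) := by
  simp [lienardPoly]

theorem conj_polarSlope {d : ℕ} (mu : Fin d → ℝ) (θ : ℝ) (x : ℂ) :
    (starRingEnd ℂ) (polarSlope (fun i => (mu i : ℂ)) θ x) =
      polarSlope (fun i => (mu i : ℂ)) θ ((starRingEnd ℂ) x) := by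
  simp only [polarSlope, polarAngular, lienardPoly, map_div₀, map_mul, map_pow, map_add, map_neg,
    map_one, map_sum, Complex.conj_ofReal]

/-- The conjugate solution has the same end value, hence coincides with `r`. Comparison with the
zero solution excludes zeros, so the sign at `2π` persists. -/
theorem IsPolarSolution.re_pos {d : ℕ} {mu : Fin d → ℝ} {ρ : ℝ}
    (h : IsScale (fun i => (mu i : ℂ)) ρ) {r : ℝ → ℂ}
    (hr : IsPolarSolution (fun i => (mu i : ℂ)) ρ r) {x : ℝ} (hx : 0 < x)
    (hrx : r (2 * Real.pi) = x) {θ : ℝ} (hθ : θ ∈ Icc 0 (2 * Real.pi)) :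
    r θ = ((r θ).re : ℂ) ∧ 0 < (r θ).re := by
  have hconj : IsPolarSolution (fun i => (mu i : ℂ)) ρ fun θ => (starRingEnd ℂ) (r θ) :=
    fun θ hθ => ⟨by rw [Complex.norm_conj]; exact (hr θ hθ).1, by
      rw [← conj_polarSlope]
      exact Complex.conjCLE.toContinuousLinearMap.hasFDerivAt.comp_hasDerivWithinAt θ (hr θ hθ).2⟩
  have hzero : IsPolarSolution (fun i => (mu i : ℂ)) ρ fun _ => 0 := fun θ hθ =>
    ⟨by simpa using h.1.le, by rw [polarSlope_zero]; exact hasDerivWithinAt_const _ _ _⟩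
  have hreal : ∀ θ ∈ Icc 0 (2 * Real.pi), r θ = ((r θ).re : ℂ) := fun θ hθ => by
    have := hr.sub_eq h hconj hθ
    rw [hrx, Complex.conj_ofReal, sub_self, zero_mul, sub_eq_zero] at this
    exact (Complex.conj_eq_iff_re.1 this.symm).symm
  have hne : ∀ θ ∈ Icc 0 (2 * Real.pi), (r θ).re ≠ 0 := fun θ hθ h0 => by
    have h1 := hr.sub_eq h hzero hθ
    rw [hreal θ hθ, h0, hrx, sub_zero, sub_zero] at h1
    refine mul_ne_zero ?_ (Complex.exp_ne_zero _) h1.symm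
    exact_mod_cast hx.ne'
  refine ⟨hreal θ hθ, ?_⟩
  by_contra! hle
  have hc : ContinuousOn (fun θ => (r θ).re) (Icc θ (2 * Real.pi)) :=
    Complex.continuous_re.comp_continuousOn (hr.continuousOn.mono (Icc_subset_Icc_left hθ.1))
  obtain ⟨η, hη, hη0⟩ := intermediate_value_Icc hθ.2 hc
    (show (0 : ℝ) ∈ _ from ⟨hle, by simp only [hrx, Complex.ofReal_re]; exact hx.le⟩)
  exact hne η ⟨hθ.1.trans hη.1, hη.2⟩ hη0

theorem IsPolarSolution.isFirstReturn {d : ℕ} {mu : Fin d → ℝ} {ρ : ℝ}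
    (h : IsScale (fun i => (mu i : ℂ)) ρ) {r : ℝ → ℂ}
    (hr : IsPolarSolution (fun i => (mu i : ℂ)) ρ r) {x : ℝ} (hx : 0 < x)
    (hrx : r (2 * Real.pi) = x) : ∃ s : ℝ, r 0 = s ∧ IsFirstReturn mu x s := by
  refine ⟨(r 0).re, (hr.re_pos h hx hrx (left_mem_Icc.2 (by positivity))).1, ?_⟩
  have key := isFirstReturn_of_polar (mu := mu) (R := fun θ => (r θ).re)
    (ω := fun θ => 1 - Real.sin θ * Real.cos θ * lienardPoly mu ((r θ).re * Real.cos θ))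
    (fun _ => rfl) fun θ hθ => ?_
  · simpa [hrx] using key
  obtain ⟨hre, hpos⟩ := hr.re_pos h hx hrx hθ
  have hp : |lienardPoly mu ((r θ).re * Real.cos θ)| ≤ 1 := by
    have := norm_lienardPoly_le h ((norm_mul_cos_le (r θ) θ).trans (hr θ hθ).1)
    rwa [hre, ← Complex.ofReal_mul, ← ofReal_lienardPoly, Complex.norm_real,
      Real.norm_eq_abs] at this
  have hb : |Real.sin θ * Real.cos θ * lienardPoly mu ((r θ).re * Real.cos θ)| ≤ 1 / 2 * 1 := by
    rw [abs_mul]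
    exact mul_le_mul (abs_sin_mul_cos_le θ) hp (abs_nonneg _) (by norm_num)
  rw [abs_le] at hb
  refine ⟨hpos, by linarith, by linarith, ?_⟩
  have hd := Complex.reCLM.hasFDerivAt.comp_hasDerivWithinAt θ (hr θ hθ).2
  refine hd.congr_deriv ?_
  have e : polarSlope (fun i => (mu i : ℂ)) θ (r θ) =
      ((-((r θ).re * lienardPoly mu ((r θ).re * Real.cos θ) * Real.sin θ ^ 2 /
        (1 - Real.sin θ * Real.cos θ * lienardPoly mu ((r θ).re * Real.cos θ))) : ℝ) : ℂ) := by
    push_cast [ofReal_lienardPoly]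
    rw [← hre, polarSlope, polarAngular, ← div_neg]
    push_cast
    congr 1
    ring
  rw [e]
  exact Complex.ofReal_re _

/-! ### The inverse of the return mapping -/

theorem lienardPoly_neg {K : Type*} [CommRing K] {d : ℕ} (lam : Fin d → K) (x : K) :
    lienardPoly (fun i => -lam i) x = -lienardPoly lam x := by
  simp [lienardPoly]

/-- The reflection `θ ↦ 2π - θ` changes the sign of `sin θ`. Together with `p ↦ -p` it preserves the
denominator and reverses the slope, so the two ends of a solution are exchanged. -/
theorem IsReturn.reverse {d : ℕ} {lam : Fin d → ℂ} {z w : ℂ}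
    (h : IsReturn (fun i => -lam i) z w) : IsReturn lam w z := by
  obtain ⟨r, hz, hw, hr⟩ := h
  have hs : ∀ θ, Real.sin (2 * Real.pi - θ) = -Real.sin θ := Real.sin_two_pi_sub
  have hc : ∀ θ, Real.cos (2 * Real.pi - θ) = Real.cos θ := Real.cos_two_pi_sub
  have hA : ∀ θ x, polarAngular (fun i => -lam i) (2 * Real.pi - θ) x = polarAngular lam θ x :=
    fun θ x => by
      rw [polarAngular, polarAngular, lienardPoly_neg, hs, hc]; push_cast; ring
  have hS : ∀ θ x, polarSlope (fun i => -lam i) (2 * Real.pi - θ) x = -polarSlope lam θ x :=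
    fun θ x => by
      rw [polarSlope, polarSlope, hA, lienardPoly_neg, hs, hc]; push_cast; ring
  refine ⟨fun θ => r (2 * Real.pi - θ), by simp [hw], by simp [hz], fun θ hθ => ?_⟩
  have hmaps : MapsTo (fun θ => 2 * Real.pi - θ) (Icc 0 (2 * Real.pi)) (Icc 0 (2 * Real.pi)) :=
    fun t ht => ⟨by linarith [ht.2], by linarith [ht.1]⟩
  obtain ⟨h1, h2⟩ := hr _ (hmaps hθ)
  rw [hA] at h1
  refine ⟨h1, ?_⟩
  refine (h2.scomp θ ((hasDerivAt_id θ).const_sub (2 * Real.pi)).hasDerivWithinAt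
    hmaps).congr_deriv ?_
  rw [hS]; simp

/-- The symmetry `(x, y, t) ↦ (x, -y, -t)` carries the field of `-mu` to that of `mu`. -/
theorem IsFirstReturn.reverse {d : ℕ} {mu : Fin d → ℝ} {r s : ℝ}
    (h : IsFirstReturn (fun i => -mu i) r s) : IsFirstReturn mu s r := by
  obtain ⟨hr, hs, T, hT, γ, hγ, h0, h1, hfirst⟩ := h
  have hmaps : MapsTo (fun t => T - t) (Icc 0 T) (Icc 0 T) :=
    fun t ht => ⟨by linarith [ht.2], by linarith [ht.1]⟩
  refine ⟨hs, hr, T, hT, fun t => ((γ (T - t)).1, -(γ (T - t)).2), fun t ht => ?_, by simp [h1],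
    by simp [h0], fun t ht hp => ?_⟩
  · have hd := (hγ _ (hmaps ht)).scomp t
      ((hasDerivAt_id t).const_sub T).hasDerivWithinAt hmaps
    have hd1 := (ContinuousLinearMap.fst ℝ ℝ ℝ).hasFDerivAt.comp_hasDerivWithinAt t hd
    have hd2 := (ContinuousLinearMap.snd ℝ ℝ ℝ).hasFDerivAt.comp_hasDerivWithinAt t hd
    refine (hd1.prodMk hd2.neg).congr_deriv ?_
    simp [lienardField, lienardPoly_neg]
  · exact hfirst (T - t) ⟨by linarith [ht.2], by linarith [ht.1]⟩ ⟨hp.1, by simpa using hp.2⟩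

/-! ### The scale `ρ` -/

theorem IsScale.neg {d : ℕ} {lam : Fin d → ℂ} {ρ : ℝ} (h : IsScale lam ρ) :
    IsScale (fun i => -lam i) ρ := ⟨h.1, by simpa using h.2⟩

theorem existsUnique_isScale {d : ℕ} {lam : Fin d → ℂ} (hlam : lam ≠ 0) :
    ∃! ρ : ℝ, IsScale lam ρ := by
  obtain ⟨j, hj⟩ := Function.ne_iff.1 hlam
  have hj' : 0 < ‖lam j‖ := norm_pos_iff.2 hj
  set f : ℝ → ℝ := fun ρ => ∑ i : Fin d, ρ ^ (i.val + 1) * ‖lam i‖ with hf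
  have hmono : StrictMonoOn f (Ici 0) := fun x hx y hy hxy => by
    refine Finset.sum_lt_sum (fun i _ => ?_) ⟨j, Finset.mem_univ j, ?_⟩
    · have := mem_Ici.1 hx
      gcongr
    · exact mul_lt_mul_of_pos_right (pow_lt_pow_left₀ hxy hx (by simp)) hj'
  have hc : Continuous f := by fun_prop
  -- For this `M` the single term of index `j` already reaches `1`, since `M ≥ 1` gives `M ^ (j + 1)
  -- ≥ M`.
  set M := max 1 ‖lam j‖⁻¹ with hM
  have hM1 : 1 ≤ M := le_max_left _ _
  have hfM : 1 ≤ f M := by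
    calc 1 = ‖lam j‖⁻¹ * ‖lam j‖ := (inv_mul_cancel₀ hj'.ne').symm
      _ ≤ M ^ (j.val + 1) * ‖lam j‖ := by
        gcongr
        exact (le_max_right _ _).trans (le_self_pow₀ hM1 (by simp))
      _ ≤ f M := Finset.single_le_sum (f := fun i : Fin d => M ^ (i.val + 1) * ‖lam i‖)
        (fun i _ => by positivity) (Finset.mem_univ j)
  have hf0 : f 0 = 0 := by simp [hf]
  obtain ⟨ρ, hρ, hρ1⟩ := intermediate_value_Icc (zero_le_one.trans hM1) hc.continuousOn
    (show (1 : ℝ) ∈ _ from ⟨by rw [hf0]; exact zero_le_one, hfM⟩)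
  have hρ0 : 0 < ρ := hρ.1.lt_of_ne (by rintro rfl; rw [hf0] at hρ1; norm_num at hρ1)
  exact ⟨ρ, ⟨hρ0, hρ1⟩, fun σ hσ => hmono.injOn hσ.1.le hρ0.le (hσ.2.trans hρ1.symm)⟩

/-- If `ρ ≤ 2`, the defining sum would be at most `2^d |λ| < 1`. So `ρ / 2 > 1`, while the other
bound never exceeds `1`. -/
theorem one_div_one_add_lt_of_sum_lt {d : ℕ} {lam : Fin d → ℂ}
    (hsmall : ∑ i, ‖lam i‖ < (1 / 2) ^ d)
    {ρ : ℝ} (h : IsScale lam ρ) : 1 / (1 + ∑ i, ‖lam i‖) < ρ / 2 := by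
  have hs : 0 ≤ ∑ i, ‖lam i‖ := Finset.sum_nonneg fun i _ => norm_nonneg _
  have hρ : 2 < ρ := by
    by_contra! hle
    have h1 : ∑ i : Fin d, ρ ^ (i.val + 1) * ‖lam i‖ ≤ ∑ i : Fin d, 2 ^ d * ‖lam i‖ := by
      refine Finset.sum_le_sum fun i _ => ?_
      gcongr
      exact (pow_le_pow_left₀ h.1.le hle _).trans (pow_le_pow_right₀ one_le_two i.2)
    rw [h.2, ← Finset.mul_sum] at h1
    have h2 : (2 : ℝ) ^ d * ∑ i, ‖lam i‖ < 2 ^ d * (1 / 2) ^ d := by gcongr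
    rw [← mul_pow] at h2
    norm_num at h2
    linarith
  have : 1 / (1 + ∑ i, ‖lam i‖) ≤ 1 := by
    rw [div_le_one (by linarith)]; linarith
  linarith

theorem exists_scale_lt_one_div {d : ℕ} (hd : 1 ≤ d) (M : ℝ) :
    ∃ mu : Fin d → ℝ, M < ∑ i, |mu i| ∧
      ∃ ρ : ℝ, IsScale (fun i => (mu i : ℂ)) ρ ∧ ρ / 2 < 1 / (1 + ∑ i, |mu i|) := by
  obtain ⟨n, rfl⟩ := Nat.exists_eq_add_of_le' hd
  set m := max M 1 + 1 with hm
  have hm1 : 1 < m := by linarith [le_max_right M 1]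
  have hmpos : 0 < m := by linarith
  have hsum : ∑ i, |(Pi.single 0 m : Fin (n + 1) → ℝ) i| = m := by
    rw [Fin.sum_univ_succ]; simp [abs_of_pos hmpos]
  -- For `p(x) = m x` the scale is `1 / m`, and `1 / (2m) < 1 / (1 + m)` as soon as `m > 1`.
  refine ⟨Pi.single 0 m, by rw [hsum]; linarith [le_max_left M 1], m⁻¹, ⟨by positivity, ?_⟩, ?_⟩
  · simp only [Complex.norm_real, Real.norm_eq_abs]
    rw [Fin.sum_univ_succ]; simp [abs_of_pos hmpos, hmpos.ne']
  · rw [hsum, inv_eq_one_div, div_div, one_div_lt_one_div (by positivity) (by positivity)]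
    linarith

/-! ### The main theorem -/

theorem mainTheorem5 (d : ℕ) (hd : 1 ≤ d) :
    -- existence and uniqueness of `ρ`, and convergence on the disc of radius `ρ / 2`
    (∀ lam : Fin d → ℂ, lam ≠ 0 →
      (∃! ρ : ℝ, IsScale lam ρ) ∧
      ∀ ρ : ℝ, IsScale lam ρ →
        -- `a`: the series of the return mapping; `b`: the series of its inverse
        ∃ a b : ℕ → ℂ,
          (∀ z : ℂ, ‖z‖ < ρ / 2 →
            ∃ w : ℂ, HasSum (fun k : ℕ => a k * z ^ k) w ∧ IsReturn lam z w) ∧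
          (∀ z : ℂ, ‖z‖ < ρ / 2 →
            ∃ w : ℂ, HasSum (fun k : ℕ => b k * z ^ k) w ∧ IsReturn lam w z) ∧
          -- for real parameters these are the first return mapping of the flow, and its inverse
          (∀ mu : Fin d → ℝ, (∀ i, lam i = (mu i : ℂ)) →
            ∀ r : ℝ, 0 < r → r < ρ / 2 →
              (∃ s : ℝ, HasSum (fun k : ℕ => a k * (r : ℂ) ^ k) (s : ℂ) ∧
                IsFirstReturn mu r s) ∧
              (∃ s : ℝ, HasSum (fun k : ℕ => b k * (r : ℂ) ^ k) (s : ℂ) ∧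
                IsFirstReturn mu s r))) ∧
    -- `ρ / 2` improves `1 / (1 + |λ|)` for small `|λ|`
    (∃ ε : ℝ, 0 < ε ∧ ∀ lam : Fin d → ℂ, lam ≠ 0 → ∑ i, ‖lam i‖ < ε →
      ∀ ρ : ℝ, IsScale lam ρ → 1 / (1 + ∑ i, ‖lam i‖) < ρ / 2) ∧
    -- but not, in general, for large `|λ|`
    (∀ M : ℝ, ∃ mu : Fin d → ℝ, M < ∑ i, |mu i| ∧
      ∃ ρ : ℝ, IsScale (fun i => (mu i : ℂ)) ρ ∧ ρ / 2 < 1 / (1 + ∑ i, |mu i|)) := by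
  refine ⟨fun lam hlam => ⟨existsUnique_isScale hlam, fun ρ h => ?_⟩,
    ⟨(1 / 2) ^ d, by positivity, fun lam _ hsmall ρ h => one_div_one_add_lt_of_sum_lt hsmall h⟩,
    exists_scale_lt_one_div hd⟩
  obtain ⟨a, ha⟩ := exists_powerSeries_polar_return h
  -- The inverse of the return mapping is the return mapping for `-lam`, so its series is obtained
  -- from the same result with the same `ρ`.
  obtain ⟨b, hb⟩ := exists_powerSeries_polar_return h.neg
  refine ⟨a, b, fun z hz => ?_, fun z hz => ?_, fun mu hmu x hx hxρ => ⟨?_, ?_⟩⟩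
  · obtain ⟨r, hr, hrz, hsum⟩ := ha z hz
    exact ⟨r 0, hsum, hrz ▸ hr.isReturn h⟩
  · obtain ⟨r, hr, hrz, hsum⟩ := hb z hz
    exact ⟨r 0, hsum, (hrz ▸ hr.isReturn h.neg).reverse⟩
  all_goals
    have hxn : ‖(x : ℂ)‖ < ρ / 2 := by rwa [Complex.norm_real, Real.norm_eq_abs, abs_of_pos hx]
    obtain rfl : lam = fun i => (mu i : ℂ) := funext hmu
  · obtain ⟨r, hr, hrz, hsum⟩ := ha x hxn
    obtain ⟨s, hs, hret⟩ := hr.isFirstReturn h hx hrz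
    exact ⟨s, hs ▸ hsum, hret⟩
  · have hneg : (fun i => -(mu i : ℂ)) = fun i => ((-mu i : ℝ) : ℂ) := by simp
    obtain ⟨r, hr, hrz, hsum⟩ := hb x hxn
    rw [hneg] at hr
    obtain ⟨s, hs, hret⟩ := hr.isFirstReturn (hneg ▸ h.neg) hx hrz
    exact ⟨s, hs ▸ hsum, hret.reverse⟩
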